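/- Let $G$ be a finitely generated nilpotent group. For a normal subgroup $H$ of finite index in $G$, let $\pi_H:\mathbb{Z}[G]\to\mathbb{Z}[G/H]$ be the ring homomorphism induced by the projection $G\to G/H$. Call a left ideal $I\subset\mathbb{Z}[G]$ \emph{finitely full} if $\pi_H(I)=\mathbb{Z}[G/H]$ for every normal subgroup $H$ of finite index in $G$. Then $\mathbb{Z}[G]$ has \emph{finitely detectable full left ideals}: every finitely full left ideal $I\subset\mathbb{Z}[G]$ is equal to $\mathbb{Z}[G]$. -/

import Mathlib

noncomputable section

/-- The natural projection `ℤ[G] → ℤ[G/H]` of integral group rings, for a normal subgroup `H`. -/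
def groupRingProj {G : Type*} [Group G] (H : Subgroup G) [H.Normal] :
    MonoidAlgebra ℤ G →+* MonoidAlgebra ℤ (G ⧸ H) :=
  MonoidAlgebra.mapDomainRingHom ℤ (QuotientGroup.mk' H)

/-- A left ideal `I` of `ℤ[G]` is finitely full if its image in `ℤ[G/H]` is all of `ℤ[G/H]`
for every normal subgroup `H` of finite index.
(In Mathlib, `Ideal` of a noncommutative ring means left ideal.) -/
def IsFinitelyFull {G : Type*} [Group G] (I : Ideal (MonoidAlgebra ℤ G)) : Prop :=
  ∀ (H : Subgroup G) [H.Normal], H.FiniteIndex →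
    (groupRingProj H) '' (I : Set (MonoidAlgebra ℤ G)) = Set.univ

/-- `ℤ[G]` has finitely detectable full left ideals if every finitely full left ideal
is equal to `ℤ[G]`. -/
def HasFinitelyDetectableFullLeftIdeals (G : Type*) [Group G] : Prop :=
  ∀ I : Ideal (MonoidAlgebra ℤ G), IsFinitelyFull I → I = ⊤

end

/-!
If `I ≠ ⊤`, a maximal left ideal `M ⊇ I` gives a simple module `V = ℤ[G] / M`. By a theorem of
P. Hall, `G` acts on `V` through a finite quotient `G / H`. An element `a ∈ I` with image `1` in
`ℤ[G / H]` then acts on `V` as the identity, although it kills the class of `1`.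

Hall's theorem rests on generic freeness: for a noetherian domain `J`, every finitely generated
`J[G]`-module becomes free over `J` after inverting some `f ≠ 0`. Indeed `G` is reached from the
trivial group by adjoining one element `u` at a time, and over the larger group ring the module is
filtered by translates `uⁿ B` of a finitely generated module `B` over the smaller one. Each layer is
a quotient of `B`, and by the argument of Hilbert's basis theorem only finitely many quotients
occur.

Now let `J` be a finitely generated commutative ring of endomorphisms of `V`. It is a domain all of
whose nonzero elements act bijectively on `V` by Schur's lemma, so generic freeness makes every
nonzero element coprime to `f` a unit of `J`. As `J` is a Jacobson ring it is a field, and it is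
finite by the Nullstellensatz over `ℤ`. Applied to `J = ℤ[d]`, this shows that the center of the
acting quotient of `G` is torsion. A finitely generated nilpotent group with torsion center is
finite.
-/

universe u w

section FreeAway

variable {J M : Type*} [CommRing J] [AddCommGroup M] [Module J M]

/-- The elements of `M` carried into `P` by some power of `f`. -/
def powSaturation (f : J) (P : Submodule J M) : Submodule J M where
  carrier := {m | ∃ k : ℕ, f ^ k • m ∈ P}
  zero_mem' := ⟨0, by simp only [smul_zero, zero_mem]⟩
  add_mem' := by
    rintro m n ⟨k, hk⟩ ⟨l, hl⟩
    refine ⟨k + l, ?_⟩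
    rw [smul_add]
    refine add_mem ?_ ?_
    · rw [pow_add, mul_comm, mul_smul]
      exact P.smul_mem _ hk
    · rw [pow_add, mul_smul]
      exact P.smul_mem _ hl
  smul_mem' := by
    rintro c m ⟨k, hk⟩
    exact ⟨k, by rw [smul_comm]; exact P.smul_mem c hk⟩

theorem le_powSaturation (f : J) (P : Submodule J M) : P ≤ powSaturation f P :=
  fun m hm ↦ ⟨0, by rwa [pow_zero, one_smul]⟩

theorem powSaturation_le_of_le {f : J} {P Q : Submodule J M} (h : P ≤ powSaturation f Q) :
    powSaturation f P ≤ powSaturation f Q := by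
  rintro m ⟨k, hk⟩
  obtain ⟨l, hl⟩ := h hk
  exact ⟨l + k, by rwa [pow_add, mul_smul]⟩

/-- `M` becomes free after inverting `f`, in the form used by P. Hall: some free submodule of `M`
contains a multiple `f ^ k • m` of each `m`. -/
def IsFreeAway (f : J) (M : Type*) [AddCommGroup M] [Module J M] : Prop :=
  ∃ s : Set M, LinearIndepOn J id s ∧ powSaturation f (Submodule.span J s) = ⊤

theorem IsFreeAway.of_dvd {f g : J} (h : f ∣ g) (hf : IsFreeAway f M) : IsFreeAway g M := by
  obtain ⟨c, rfl⟩ := h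
  obtain ⟨s, hs, hspan⟩ := hf
  refine ⟨s, hs, top_unique fun m _ ↦ ?_⟩
  obtain ⟨k, hk⟩ := hspan.ge (Submodule.mem_top (x := m))
  refine ⟨k, ?_⟩
  rw [mul_pow, mul_comm, mul_smul]
  exact Submodule.smul_mem _ _ hk

section Filtration

variable {ι : Type*} [LinearOrder ι] {P : ι → Submodule J M} {t : ι → Set M}

theorem linearIndepOn_iUnion_of_mkQ (htP : ∀ i, t i ⊆ P i)
    (ht : ∀ i, LinearIndepOn J (⨆ j < i, P j).mkQ (t i)) :
    LinearIndepOn J id (⋃ i, t i) := by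
  have hfin : ∀ I : Finset ι, LinearIndepOn J id (⋃ i ∈ I, t i) := by
    intro I
    induction I using Finset.induction_on_max with
    | empty => simp only [Finset.notMem_empty, Set.iUnion_of_empty, Set.iUnion_empty,
        linearIndepOn_empty]
    | insert i I hI ih =>
      rw [Finset.set_biUnion_insert, Set.union_comm]
      refine LinearIndepOn.union_id_of_quotient ?_ ih (ht i)
      exact Set.iUnion₂_subset fun j hj ↦ (htP j).trans (le_iSup₂ (f := fun j _ ↦ P j) j (hI j hj))
  rw [Set.iUnion_eq_iUnion_finset]
  refine linearIndepOn_iUnion_of_directed (Monotone.directed_le fun I I' h ↦ ?_) hfin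
  exact Set.biUnion_subset_biUnion_left h

theorem iSup_le_powSaturation_span_iUnion [WellFoundedLT ι] {f : J}
    (ht : ∀ i, P i ≤ powSaturation f ((⨆ j < i, P j) ⊔ Submodule.span J (t i))) :
    ⨆ i, P i ≤ powSaturation f (Submodule.span J (⋃ i, t i)) := by
  refine iSup_le fun i ↦ ?_
  induction i using WellFoundedLT.induction with
  | ind i ih =>
    refine (ht i).trans (powSaturation_le_of_le (sup_le (iSup₂_le ih) ?_))
    exact (Submodule.span_mono (Set.subset_iUnion t i)).trans (le_powSaturation _ _)

end Filtration

theorem exists_injective_comp_eq_of_ker_eq {X Y : Type*} [AddCommGroup X] [Module J X]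
    [AddCommGroup Y] [Module J Y] {g : X →ₗ[J] M} {π : X →ₗ[J] Y} (hπ : Function.Surjective π)
    (hker : π.ker = g.ker) : ∃ ψ : Y →ₗ[J] M, ψ.ker = ⊥ ∧ ∀ x, ψ (π x) = g x := by
  have hψ (x : X) :
      (π.ker.liftQ g hker.le ∘ₗ (π.quotKerEquivOfSurjective hπ).symm) (π x) = g x := by
    simp only [LinearMap.comp_apply, LinearEquiv.coe_coe,
      LinearMap.quotKerEquivOfSurjective_symm_apply, Submodule.liftQ_apply]
  refine ⟨_, LinearMap.ker_eq_bot'.2 fun y hy ↦ ?_, hψ⟩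
  obtain ⟨x, rfl⟩ := hπ y
  rwa [hψ, ← LinearMap.mem_ker, ← hker] at hy

theorem IsFreeAway.exists_lift {f : J} {X Y : Type*} [AddCommGroup X] [Module J X]
    [AddCommGroup Y] [Module J Y] (hY : IsFreeAway f Y) (φ : X →ₗ[J] M) (π : X →ₗ[J] Y)
    (hπ : Function.Surjective π) {N : Submodule J M} (hker : π.ker = N.comap φ) :
    ∃ t ⊆ (φ.range : Set M), LinearIndepOn J N.mkQ t ∧
      φ.range ≤ powSaturation f (N ⊔ Submodule.span J t) := by
  obtain ⟨s, hs, hspan⟩ := hY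
  obtain ⟨g, hg⟩ := hπ.hasRightInverse
  obtain ⟨ψ, hψ, hψπ⟩ := exists_injective_comp_eq_of_ker_eq (g := N.mkQ ∘ₗ φ) hπ
    (by rw [LinearMap.ker_comp, Submodule.ker_mkQ, hker])
  have hψg : N.mkQ ∘ φ ∘ g = ψ := funext fun y ↦ (hψπ (g y)).symm.trans (congrArg ψ (hg y))
  refine ⟨(φ ∘ g) '' s, ?_, ?_, ?_⟩
  · rintro _ ⟨y, -, rfl⟩
    exact ⟨g y, rfl⟩
  · refine LinearIndepOn.image_of_comp _ _ ?_
    rw [hψg]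
    exact LinearIndependent.map' hs ψ hψ
  · rintro _ ⟨x, rfl⟩
    obtain ⟨k, hk⟩ := hspan.ge (Submodule.mem_top (x := π x))
    refine ⟨k, ?_⟩
    rw [← map_smul, sup_comm, ← Submodule.ker_mkQ N, ← Submodule.comap_map_eq,
      Submodule.mem_comap, Submodule.map_span, ← Set.image_comp, hψg, ← Submodule.map_span]
    exact ⟨f ^ k • π x, hk, by rw [← map_smul, hψπ, LinearMap.comp_apply]⟩

theorem IsFreeAway.of_filtration {ι : Type*} [LinearOrder ι] [WellFoundedLT ι] {f : J}
    {X Y : ι → Type*} [∀ i, AddCommGroup (X i)] [∀ i, Module J (X i)] [∀ i, AddCommGroup (Y i)]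
    [∀ i, Module J (Y i)] (φ : ∀ i, X i →ₗ[J] M) (π : ∀ i, X i →ₗ[J] Y i)
    (hφ : ⨆ i, (φ i).range = ⊤) (hπ : ∀ i, Function.Surjective (π i))
    (hker : ∀ i, (π i).ker = (⨆ j < i, (φ j).range).comap (φ i))
    (hY : ∀ i, IsFreeAway f (Y i)) : IsFreeAway f M := by
  choose t htφ ht htspan using fun i ↦ (hY i).exists_lift (φ i) (π i) (hπ i) (hker i)
  exact ⟨⋃ i, t i, linearIndepOn_iUnion_of_mkQ htφ ht,
    top_unique (hφ.ge.trans (iSup_le_powSaturation_span_iUnion htspan))⟩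

variable (J M) in
theorem exists_isFreeAway [IsDomain J] [Module.Finite J M] :
    ∃ f : J, f ≠ 0 ∧ IsFreeAway f M := by
  obtain ⟨s, hcard, hs⟩ := exists_set_linearIndependent_of_isDomain J M
  have hrank : Module.rank J (M ⧸ Submodule.span J s) = 0 := by
    have hadd := rank_quotient_add_rank_of_isDomain (Submodule.span J s)
    rw [rank_span_set hs, hcard] at hadd
    exact Cardinal.eq_of_add_eq_add_right (hadd.trans (zero_add _).symm) (Module.rank_lt_aleph0 J M)
  obtain ⟨f, hf, hf0⟩ := Submodule.annihilator_top_inter_nonZeroDivisors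
    (Module.rank_eq_zero_iff_isTorsion.1 hrank)
  refine ⟨f, nonZeroDivisors.ne_zero hf0, s, hs, top_unique fun m _ ↦ ⟨1, ?_⟩⟩
  rw [pow_one, ← Submodule.Quotient.mk_eq_zero, Submodule.Quotient.mk_smul]
  exact Submodule.mem_annihilator.1 hf _ Submodule.mem_top

theorem IsFreeAway.isUnit_of_surjective_smul [Nontrivial M] {f q : J} (hM : IsFreeAway f M)
    (hf : Function.Injective fun m : M ↦ f • m) (hq : Function.Surjective fun m : M ↦ q • m)
    (hqf : IsCoprime q f) : IsUnit q := by
  obtain ⟨s, hs, hspan⟩ := hM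
  obtain ⟨x, hx⟩ : s.Nonempty := by
    by_contra hs0
    obtain ⟨m, hm⟩ := exists_ne (0 : M)
    obtain ⟨k, hk⟩ := hspan.ge (Submodule.mem_top (x := m))
    rw [Set.not_nonempty_iff_eq_empty.1 hs0, Submodule.span_empty, Submodule.mem_bot] at hk
    refine hm ((hf.iterate k) ?_)
    simpa only [smul_iterate, smul_zero] using hk
  obtain ⟨y, hy⟩ := hq x
  obtain ⟨k, hk⟩ := hspan.ge (Submodule.mem_top (x := y))
  suffices q ∣ f ^ k from (hqf.pow_right.isUnit_of_dvd' dvd_rfl this)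
  let b := Module.Basis.span (v := ((↑) : s → M)) hs
  have hky : f ^ k • y ∈ Submodule.span J (Set.range ((↑) : s → M)) := by
    rwa [Subtype.range_coe]
  have hb : q • ⟨f ^ k • y, hky⟩ = f ^ k • b ⟨x, hx⟩ := by
    ext
    have hbx : (b ⟨x, hx⟩ : M) = x := Module.Basis.coe_span_apply hs _
    rw [Submodule.coe_smul, Submodule.coe_smul, hbx, ← hy]
    exact smul_comm ..
  refine ⟨b.coord ⟨x, hx⟩ ⟨f ^ k • y, hky⟩, ?_⟩
  rw [← smul_eq_mul, ← map_smul, hb, map_smul, b.coord_apply, b.repr_self,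
    Finsupp.single_eq_same, smul_eq_mul, mul_one]

end FreeAway

section HilbertBasis

theorem wellFoundedGT_natOrderHom (α : Type*) [PartialOrder α] [WellFoundedGT α] :
    WellFoundedGT (ℕ →o α) := by
  have stab (s : ℕ →o α) := wellFoundedGT_iff_monotone_chain_condition.1 ‹_› s
  refine wellFoundedGT_iff_monotone_chain_condition.2 fun a ↦ ?_
  obtain ⟨d, hd⟩ := stab ⟨fun n ↦ a n n, fun m n h ↦ (a.2 h m).trans ((a n).2 h)⟩
  choose c hc using fun i ↦ stab ⟨fun n ↦ a n i, fun m n h ↦ a.2 h i⟩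
  set N := d ⊔ (Finset.range d).sup c
  have hstable {n i : ℕ} (hn : N ≤ n) : a N i = a n i := by
    rcases lt_or_ge i d with hi | hi
    · have hcN : c i ≤ N := (Finset.le_sup (Finset.mem_range.2 hi)).trans le_sup_right
      exact (hc i N hcN).symm.trans (hc i n (hcN.trans hn))
    · have hdiag {m : ℕ} (hm : N ≤ m) : a m i = a d d := by
        have hdm : d ≤ m := le_sup_left.trans hm
        refine le_antisymm ?_ ((a.2 hdm d).trans ((a m).2 hi))
        calc a m i ≤ a (m ⊔ i) (m ⊔ i) := (a.2 le_sup_left i).trans ((a _).2 le_sup_right)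
          _ = a d d := (hd _ (hdm.trans le_sup_left)).symm
      rw [hdiag le_rfl, hdiag hn]
  exact ⟨N, fun n hn ↦ OrderHom.ext _ _ (funext fun i ↦ hstable hn)⟩

variable {L : Type*} [CompleteLattice L] (τ : L ≃o L) (b : L)

/-- The elements of `b` that occur as the coefficient of `uⁿ` in a polynomial of degree at most `n`
lying in `a`, when `L` is a lattice of submodules, `b` generates and `τ` is multiplication by
`u`. -/
def leadingPart (a : L) (n : ℕ) : L :=
  b ⊓ (τ ^ n)⁻¹ (a ⊔ ⨆ k < n, (τ ^ k) b)

variable {τ b}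

theorem leadingPart_le (a : L) (n : ℕ) : leadingPart τ b a n ≤ b :=
  inf_le_left

theorem leadingPart_mono_left (n : ℕ) : Monotone fun a ↦ leadingPart τ b a n :=
  fun _ _ h ↦ inf_le_inf_left b ((τ ^ n)⁻¹.monotone (sup_le_sup_right h _))

theorem leadingPart_monotone {a : L} (ha : τ a = a) : Monotone (leadingPart τ b a) := by
  refine monotone_nat_of_le_succ fun n ↦ inf_le_inf_left b ?_
  rw [← (τ ^ (n + 1)).le_iff_le, RelIso.apply_inv_self, pow_succ', RelIso.mul_apply,
    RelIso.apply_inv_self, map_sup, ha]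
  simp only [OrderIso.map_iSup, ← RelIso.mul_apply, ← pow_succ']
  refine sup_le_sup_left (iSup₂_le fun k hk ↦ ?_) a
  exact le_iSup₂ (f := fun k (_ : k < n + 1) ↦ (τ ^ k) b) (k + 1) (Nat.add_lt_add_right hk 1)

theorem map_leadingPart (a : L) (n : ℕ) :
    (τ ^ n) (leadingPart τ b a n) = (τ ^ n) b ⊓ (a ⊔ ⨆ k < n, (τ ^ k) b) := by
  rw [leadingPart, map_inf, RelIso.apply_inv_self]

theorem inf_iSup_le_of_leadingPart_le [IsModularLattice L] {a a' : L} (h : a' ≤ a)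
    (hK : ∀ n, leadingPart τ b a n ≤ leadingPart τ b a' n) (n : ℕ) :
    a ⊓ ⨆ k < n, (τ ^ k) b ≤ a' := by
  induction n with
  | zero => simp only [not_lt_zero, iSup_false, iSup_bot, inf_bot_eq, bot_le]
  | succ n ih =>
    have hlead := (τ ^ n).monotone (hK n)
    rw [map_leadingPart, map_leadingPart] at hlead
    rw [Nat.iSup_lt_succ]
    set F := ⨆ k < n, (τ ^ k) b
    have hF : a ⊓ (F ⊔ (τ ^ n) b) ≤ a' ⊔ F :=
      calc a ⊓ (F ⊔ (τ ^ n) b) ≤ (F ⊔ (τ ^ n) b) ⊓ (a ⊔ F) :=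
            le_inf inf_le_right (inf_le_left.trans le_sup_left)
        _ = F ⊔ (τ ^ n) b ⊓ (a ⊔ F) := (sup_inf_assoc_of_le _ le_sup_right)
        _ ≤ a' ⊔ F := sup_le le_sup_right (hlead.trans inf_le_right)
    calc a ⊓ (F ⊔ (τ ^ n) b) ≤ (a' ⊔ F) ⊓ a := le_inf hF inf_le_left
      _ = a' ⊔ F ⊓ a := sup_inf_assoc_of_le _ h
      _ ≤ a' := sup_le le_rfl (inf_comm F a ▸ ih)

theorem exists_finset_sup_le_zpow_iSup (s : Finset ℤ) :
    ∃ m n : ℕ, ⨆ k ∈ s, (τ ^ k) b ≤ (τ ^ m)⁻¹ (⨆ k < n, (τ ^ k) b) := by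
  refine ⟨s.sup Int.natAbs, 2 * s.sup Int.natAbs + 1, iSup₂_le fun k hk ↦ ?_⟩
  set m := s.sup Int.natAbs
  have hkm : k.natAbs ≤ m := Finset.le_sup hk
  obtain ⟨i, hi⟩ := Int.eq_ofNat_of_zero_le (show 0 ≤ k + m by omega)
  have hshift : (τ ^ k) b = (τ ^ m)⁻¹ ((τ ^ i) b) := by
    rw [← RelIso.mul_apply, ← zpow_natCast τ i, ← hi, ← zpow_natCast τ m, ← zpow_neg, ← zpow_add]
    congr 2
    ring
  rw [hshift]
  exact (τ ^ m)⁻¹.monotone (le_iSup₂ (f := fun k (_ : k < 2 * m + 1) ↦ (τ ^ k) b) i (by omega))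

theorem le_of_leadingPart_le [IsModularLattice L] [IsCompactlyGenerated L] {a a' : L} (h : a' ≤ a)
    (ha : τ a = a) (ha' : τ a' = a') (hb : ⨆ n : ℤ, (τ ^ n) b = ⊤)
    (hK : ∀ n, leadingPart τ b a n ≤ leadingPart τ b a' n) : a ≤ a' := by
  have hfix {c : L} (hc : τ c = c) (m : ℕ) : (τ ^ m) c = c := by
    induction m with
    | zero => rw [pow_zero, RelIso.one_apply]
    | succ m ih => rw [pow_succ, RelIso.mul_apply, hc, ih]
  rw [← inf_top_eq a, ← hb, iSup_eq_iSup_finset, Directed.inf_iSup_eq]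
  · refine iSup_le fun s ↦ ?_
    obtain ⟨m, n, hmn⟩ := exists_finset_sup_le_zpow_iSup (τ := τ) (b := b) s
    refine (inf_le_inf_left a hmn).trans ?_
    rw [← (τ ^ m).le_iff_le, map_inf, RelIso.apply_inv_self, hfix ha, hfix ha']
    exact inf_iSup_le_of_leadingPart_le h hK n
  · exact Monotone.directed_le fun s t hst ↦ biSup_mono fun _ hk ↦ Finset.mem_of_subset hst hk

theorem wellFoundedGT_fixedPoints [IsModularLattice L] [IsCompactlyGenerated L]
    [WellFoundedGT (Set.Iic b)] (hb : ⨆ n : ℤ, (τ ^ n) b = ⊤) : WellFoundedGT {a // τ a = a} := by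
  have := wellFoundedGT_natOrderHom (Set.Iic b)
  let K (a : {a // τ a = a}) : ℕ →o Set.Iic b :=
    ⟨fun n ↦ ⟨leadingPart τ b a n, leadingPart_le _ _⟩, leadingPart_monotone a.2⟩
  have hKmono : Monotone K := fun a a' h n ↦ leadingPart_mono_left n h
  refine StrictMono.wellFoundedGT (f := K) fun a a' h ↦ (hKmono h.le).lt_of_not_ge fun hle ↦ ?_
  exact h.not_ge (le_of_leadingPart_le h.le a'.2 a.2 hb fun n ↦ hle n)

end HilbertBasis

section LaurentOrder

/-- The exponents `0, 1, 2, …, -1, -2, …`, in this order. Adjoining the powers of a unit in this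
order, only finitely many relation modules occur, see `finite_range_relationPart`. -/
def laurentExponent (i : Bool ×ₗ ℕ) : ℤ :=
  bif (ofLex i).1 then Int.negSucc (ofLex i).2 else (ofLex i).2

theorem laurentExponent_surjective : Function.Surjective laurentExponent := by
  rintro (n | n)
  exacts [⟨toLex (false, n), rfl⟩, ⟨toLex (true, n), rfl⟩]

theorem lt_toLex_false {j : Bool ×ₗ ℕ} {n : ℕ} :
    j < toLex (false, n) ↔ 0 ≤ laurentExponent j ∧ laurentExponent j < n := by
  obtain ⟨⟨_ | _, m⟩, rfl⟩ := toLex.surjective j <;>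
    simp [Prod.Lex.toLex_lt_toLex, laurentExponent]

theorem lt_toLex_true {j : Bool ×ₗ ℕ} {n : ℕ} :
    j < toLex (true, n) ↔ -(n : ℤ) ≤ laurentExponent j := by
  rw [Prod.Lex.lt_iff, laurentExponent]
  obtain ⟨⟨_ | _, m⟩, rfl⟩ := toLex.surjective j <;>
    simp only [ofLex_toLex, cond_true, cond_false, Bool.false_lt_true, lt_self_iff_false, true_or,
      false_or, true_and, true_iff] <;>
    omega

variable {L : Type*} [CompleteLattice L] (τ : L ≃o L) (b : L)

/-- When `L` is a lattice of submodules and `τ` is multiplication by `u`: the elements of `b` that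
are killed on passing from `b` to the `i`-th layer of the filtration by the sums of the `uᵏ b`, with
the exponents `k` ordered by `laurentExponent`. -/
def relationPart (i : Bool ×ₗ ℕ) : L :=
  b ⊓ (τ ^ laurentExponent i)⁻¹ (⨆ j < i, (τ ^ laurentExponent j) b)

theorem relationPart_false (n : ℕ) :
    relationPart τ b (toLex (false, n)) = leadingPart τ b ⊥ n := by
  have hsup : ⨆ j < toLex (false, n), (τ ^ laurentExponent j) b = ⨆ k < n, (τ ^ k) b := by
    refine le_antisymm (iSup₂_le fun j hj ↦ ?_) (iSup₂_le fun k hk ↦ ?_)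
    · obtain ⟨hj0, hjn⟩ := lt_toLex_false.1 hj
      obtain ⟨k, hk⟩ := Int.eq_ofNat_of_zero_le hj0
      rw [hk, zpow_natCast]
      exact le_iSup₂ (f := fun k (_ : k < n) ↦ (τ ^ k) b) k (by omega)
    · exact le_iSup₂ (f := fun j (_ : j < toLex (false, n)) ↦ (τ ^ laurentExponent j) b)
        (toLex (false, k)) (lt_toLex_false.2 ⟨Int.natCast_nonneg k, Int.ofNat_lt.2 hk⟩)
  rw [relationPart, leadingPart, hsup, bot_sup_eq]
  rfl

theorem relationPart_true (n : ℕ) :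
    relationPart τ b (toLex (true, n)) = b ⊓ ⨆ k > (0 : ℤ), (τ ^ k) b := by
  have hexp : laurentExponent (toLex (true, n)) = -(n + 1) := Int.negSucc_eq n
  rw [relationPart, hexp, ← zpow_neg, neg_neg]
  simp only [OrderIso.map_iSup, ← RelIso.mul_apply, ← zpow_add]
  refine congrArg _ (le_antisymm (iSup₂_le fun j hj ↦ ?_) (iSup₂_le fun k hk ↦ ?_))
  · have := lt_toLex_true.1 hj
    exact le_iSup₂ (f := fun k (_ : k > 0) ↦ (τ ^ k) b) (n + 1 + laurentExponent j) (by omega)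
  · obtain ⟨j, hj⟩ := laurentExponent_surjective (k - (n + 1))
    refine le_iSup₂_of_le j (lt_toLex_true.2 (by omega)) (le_of_eq ?_)
    rw [hj, add_sub_cancel]

theorem finite_range_of_monotone {α : Type*} [PartialOrder α] [WellFoundedGT α] {a : ℕ → α}
    (ha : Monotone a) : (Set.range a).Finite := by
  obtain ⟨n, hn⟩ := wellFoundedGT_iff_monotone_chain_condition.1 ‹_› ⟨a, ha⟩
  refine ((Set.finite_Iic n).image a).subset ?_
  rintro _ ⟨m, rfl⟩
  rcases le_total m n with h | h
  · exact ⟨m, h, rfl⟩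
  · exact ⟨n, Set.self_mem_Iic, hn m h⟩

theorem finite_range_relationPart [WellFoundedGT (Set.Iic b)] :
    (Set.range (relationPart τ b)).Finite := by
  have hfin : (Set.range (leadingPart τ b ⊥)).Finite := by
    let K (n : ℕ) : Set.Iic b := ⟨leadingPart τ b ⊥ n, leadingPart_le _ _⟩
    have hK : Monotone K := leadingPart_monotone (map_bot τ)
    have := (finite_range_of_monotone hK).image Subtype.val
    rwa [← Set.range_comp] at this
  refine (hfin.insert (b ⊓ ⨆ k > (0 : ℤ), (τ ^ k) b)).subset ?_
  rintro _ ⟨⟨_ | _, n⟩, rfl⟩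
  · exact Or.inr ⟨n, (relationPart_false τ b n).symm⟩
  · exact Or.inl (relationPart_true τ b n)

end LaurentOrder

section LaurentExtension

variable {J S : Type*} [CommRing J] [Ring S] [Algebra J S]

/-- `S` is generated by a subalgebra `R` and a unit `u` with `u R u⁻¹ = R`, like the ring of skew
Laurent polynomials in `u` over `R`, but without any freeness requirement. -/
structure IsLaurentExtension (R : Subalgebra J S) (u : Sˣ) : Prop where
  conj_mem : ∀ r ∈ R, ↑u * r * ↑u⁻¹ ∈ R
  conj_inv_mem : ∀ r ∈ R, ↑u⁻¹ * r * ↑u ∈ R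
  adjoin_eq_top : Algebra.adjoin J (R ∪ {↑u, ↑u⁻¹} : Set S) = ⊤

namespace IsLaurentExtension

variable {R : Subalgebra J S} {u : Sˣ} {M : Type*} [AddCommGroup M] [Module S M]

theorem symm (h : IsLaurentExtension R u) : IsLaurentExtension R u⁻¹ where
  conj_mem r hr := by simpa only [inv_inv] using h.conj_inv_mem r hr
  conj_inv_mem r hr := by simpa only [inv_inv] using h.conj_mem r hr
  adjoin_eq_top := by rw [inv_inv, Set.pair_comm, h.adjoin_eq_top]

/-- The submodule `u W`. -/
def unitSMul (h : IsLaurentExtension R u) (W : Submodule R M) : Submodule R M where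
  carrier := {m | u⁻¹ • m ∈ W}
  zero_mem' := by rw [Set.mem_ofPred_eq, smul_zero]; exact W.zero_mem
  add_mem' hx hy := by rw [Set.mem_ofPred_eq, smul_add]; exact W.add_mem hx hy
  smul_mem' r m hm := by
    have hr : u⁻¹ • r • m = (⟨_, h.conj_inv_mem r r.2⟩ : R) • u⁻¹ • m := by
      simp only [Units.smul_def, Subalgebra.smul_def, ← mul_smul, mul_assoc, Units.mul_inv, mul_one]
    rw [Set.mem_ofPred_eq, hr]
    exact W.smul_mem _ hm

theorem mem_unitSMul {h : IsLaurentExtension R u} {W : Submodule R M} {m : M} :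
    m ∈ h.unitSMul W ↔ u⁻¹ • m ∈ W :=
  Iff.rfl

variable (M) in
/-- Multiplication by `u` as an automorphism of the lattice of `R`-submodules of an `S`-module. -/
def latticeAut (h : IsLaurentExtension R u) : Submodule R M ≃o Submodule R M where
  toFun := h.unitSMul
  invFun := h.symm.unitSMul
  left_inv W := by ext m; rw [mem_unitSMul, mem_unitSMul, inv_inv, inv_smul_smul]
  right_inv W := by ext m; rw [mem_unitSMul, mem_unitSMul, inv_inv, smul_inv_smul]
  map_rel_iff' {W W'} := by
    refine ⟨fun hW m hm ↦ ?_, fun hW m hm ↦ hW hm⟩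
    have hum : u • m ∈ h.unitSMul W := by rwa [mem_unitSMul, inv_smul_smul]
    have hum' : u • m ∈ h.unitSMul W' := hW hum
    rwa [mem_unitSMul, inv_smul_smul] at hum'

variable (h : IsLaurentExtension R u)
include h

theorem mem_latticeAut {W : Submodule R M} {m : M} : m ∈ h.latticeAut M W ↔ u⁻¹ • m ∈ W :=
  Iff.rfl

theorem mem_zpow_latticeAut (n : ℤ) {W : Submodule R M} {m : M} :
    m ∈ (h.latticeAut M ^ n) W ↔ (u ^ n)⁻¹ • m ∈ W := by
  induction n generalizing W with
  | zero => rw [zpow_zero, RelIso.one_apply, zpow_zero, inv_one, one_smul]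
  | succ n ih =>
    rw [zpow_add_one, RelIso.mul_apply, ih, zpow_add_one, mul_inv_rev, mul_smul, mem_latticeAut]
  | pred n ih =>
    rw [zpow_sub_one, RelIso.mul_apply, ih, zpow_sub_one, mul_inv_rev, mul_smul]
    exact h.symm.mem_latticeAut

theorem smul_mem_of_latticeAut_eq {W : Submodule R M} (hW : h.latticeAut M W = W) (s : S) {m : M}
    (hm : m ∈ W) : s • m ∈ W := by
  have hs : s ∈ Algebra.adjoin J (R ∪ {↑u, ↑u⁻¹} : Set S) := h.adjoin_eq_top ▸ Algebra.mem_top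
  induction hs using Algebra.adjoin_induction generalizing m with
  | mem s hs =>
    rcases hs with hs | rfl | rfl
    · exact W.smul_mem (⟨s, hs⟩ : R) hm
    · rwa [← hW, mem_latticeAut, ← Units.smul_def, inv_smul_smul]
    · rwa [← hW, mem_latticeAut] at hm
  | algebraMap c => exact W.smul_mem (algebraMap J R c) hm
  | add s t _ _ hs ht => rw [add_smul]; exact W.add_mem (hs hm) (ht hm)
  | mul s t _ _ hs ht => rw [mul_smul]; exact hs (ht hm)

theorem iSup_zpow_latticeAut_eq_top {B : Submodule R M}
    (hB : Submodule.span S (B : Set M) = ⊤) : ⨆ n : ℤ, (h.latticeAut M ^ n) B = ⊤ := by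
  set W := ⨆ n : ℤ, (h.latticeAut M ^ n) B
  have hW : h.latticeAut M W = W := by
    simp only [W, OrderIso.map_iSup, ← RelIso.mul_apply, ← zpow_one_add]
    exact (Equiv.addLeft (1 : ℤ)).iSup_congr fun _ ↦ rfl
  let W' : Submodule S M := { W with smul_mem' := fun s _ ↦ h.smul_mem_of_latticeAut_eq hW s }
  have hBW : B ≤ W := le_iSup (fun n : ℤ ↦ (h.latticeAut M ^ n) B) 0
  have hW' : W' = ⊤ := top_unique (hB.ge.trans (Submodule.span_le.2 hBW))
  exact top_unique fun m _ ↦ hW'.ge (Submodule.mem_top (x := m))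

theorem mem_relationPart {B : Submodule R M} {i : Bool ×ₗ ℕ} {m : M} :
    m ∈ relationPart (h.latticeAut M) B i ↔ m ∈ B ∧
      u ^ laurentExponent i • m ∈ ⨆ j < i, (h.latticeAut M ^ laurentExponent j) B := by
  rw [relationPart, Submodule.mem_inf, ← zpow_neg, h.mem_zpow_latticeAut, zpow_neg, inv_inv]

variable (M) in
theorem isNoetherian [IsNoetherianRing R] [Module.Finite S M] : IsNoetherian S M := by
  obtain ⟨s, hs⟩ := Module.Finite.fg_top (R := S) (M := M)
  set B := Submodule.span R (s : Set M)
  have hB : Submodule.span S (B : Set M) = ⊤ :=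
    top_unique (hs.ge.trans (Submodule.span_mono Submodule.subset_span))
  have : IsNoetherian R B := isNoetherian_span_of_finite R s.finite_toSet
  have : WellFoundedGT (Set.Iic B) := (Submodule.mapIic B).symm.strictMono.wellFoundedGT
  have := wellFoundedGT_fixedPoints (h.iSup_zpow_latticeAut_eq_top hB)
  let F (N : Submodule S M) : {W : Submodule R M // h.latticeAut M W = W} :=
    ⟨N.restrictScalars R, Submodule.ext fun m ↦ by
      exact N.smul_mem_iff_of_isUnit (u⁻¹).isUnit⟩
  have hF : StrictMono F := fun N N' hN ↦ hN
  exact isNoetherian_iff'.2 hF.wellFoundedGT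

theorem isNoetherianRing [IsNoetherianRing R] : IsNoetherianRing S :=
  isNoetherianRing_iff.2 (h.isNoetherian S)

end IsLaurentExtension

end LaurentExtension

section HallAlgebra

/-- The two properties of the group rings of polycyclic groups on which P. Hall's theorem on simple
modules rests. The second one says that every finitely generated `R`-module becomes free over `J`
after inverting a nonzero element of `J`. -/
structure IsHallAlgebra (J : Type*) (R : Type*) [CommRing J] [Ring R] [Algebra J R] : Prop where
  isNoetherianRing : IsNoetherianRing R
  exists_isFreeAway : ∀ (M : Type w) [AddCommGroup M] [Module J M] [Module R M]
    [IsScalarTower J R M] [Module.Finite R M], ∃ f : J, f ≠ 0 ∧ IsFreeAway f M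

variable {J R S : Type*} [CommRing J] [Ring R] [Algebra J R] [Ring S] [Algebra J S]

variable (J) in
theorem isHallAlgebra_self [IsDomain J] [IsNoetherianRing J] : IsHallAlgebra.{w} J J where
  isNoetherianRing := inferInstance
  exists_isFreeAway := by
    intro M _ m₁ m₂ _ _
    obtain rfl : m₁ = m₂ := by
      refine Module.ext' m₁ m₂ fun r x ↦ ?_
      have hrx := @IsScalarTower.smul_assoc J J M _ m₂.toSMul m₁.toSMul _ r 1 x
      rwa [smul_eq_mul, mul_one, one_smul, eq_comm] at hrx
    exact exists_isFreeAway J M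

theorem finite_compHom_of_surjective {φ : R →+* S} (hφ : Function.Surjective φ) (M : Type*)
    [AddCommGroup M] [Module S M] [Module.Finite S M] :
    letI := Module.compHom M φ; Module.Finite R M := by
  let _ := Module.compHom M φ
  obtain ⟨s, hs⟩ := Module.Finite.fg_top (R := S) (M := M)
  refine ⟨s, top_unique fun m _ ↦ ?_⟩
  induction hs.ge (Submodule.mem_top (x := m)) using Submodule.span_induction with
  | mem m hm => exact Submodule.subset_span hm
  | zero => exact zero_mem _
  | add m n _ _ hm hn => exact add_mem (hm ⟨⟩) (hn ⟨⟩)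
  | smul a m _ hm =>
    obtain ⟨r, rfl⟩ := hφ a
    exact Submodule.smul_mem _ r (hm ⟨⟩)

namespace IsHallAlgebra

theorem of_surjective (hR : IsHallAlgebra.{w} J R) (φ : R →ₐ[J] S)
    (hφ : Function.Surjective φ) : IsHallAlgebra.{w} J S where
  isNoetherianRing := by
    have := hR.isNoetherianRing
    exact isNoetherianRing_of_surjective R S φ.toRingHom hφ
  exists_isFreeAway := by
    intro M _ _ _ _ _
    let _ : Module R M := Module.compHom M φ.toRingHom
    have : IsScalarTower J R M := ⟨fun c r m ↦ by
      change φ (c • r) • m = c • φ r • m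
      rw [map_smul, smul_assoc]⟩
    have : Module.Finite R M := finite_compHom_of_surjective (φ := φ.toRingHom) hφ M
    exact hR.exists_isFreeAway M

theorem exists_isFreeAway_quotient [IsDomain J] (hR : IsHallAlgebra.{w} J R) {M : Type w}
    [AddCommGroup M] [Module J M] [Module R M] [IsScalarTower J R M] [Module.Finite R M]
    {s : Set (Submodule R M)} (hs : s.Finite) :
    ∃ f : J, f ≠ 0 ∧ ∀ K ∈ s, IsFreeAway f (M ⧸ K) := by
  choose g hg0 hg using fun K : Submodule R M ↦ hR.exists_isFreeAway (M ⧸ K)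
  refine ⟨∏ K ∈ hs.toFinset, g K, Finset.prod_ne_zero_iff.2 fun K _ ↦ hg0 K, fun K hK ↦ ?_⟩
  exact (hg K).of_dvd (Finset.dvd_prod_of_mem g (hs.mem_toFinset.2 hK))

end IsHallAlgebra

theorem IsLaurentExtension.isFreeAway {R : Subalgebra J S} {u : Sˣ} (h : IsLaurentExtension R u)
    {M : Type*} [AddCommGroup M] [Module J M] [Module S M] [IsScalarTower J S M] {B : Submodule R M}
    (hB : Submodule.span S (B : Set M) = ⊤) {f : J}
    (hf : ∀ i, IsFreeAway f (B ⧸ (relationPart (h.latticeAut M) B i).submoduleOf B)) :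
    IsFreeAway f M := by
  let φ (n : ℤ) : B →ₗ[J] M :=
    DistribSMul.toLinearMap J M (u ^ n) ∘ₗ B.subtype.restrictScalars J
  have hrange (n : ℤ) : (φ n).range = ((h.latticeAut M ^ n) B).restrictScalars J := by
    ext m
    rw [Submodule.restrictScalars_mem, h.mem_zpow_latticeAut, LinearMap.mem_range]
    constructor
    · rintro ⟨x, rfl⟩
      have hx := x.2
      rwa [← inv_smul_smul (u ^ n) (x : M)] at hx
    · intro hm
      let x : B := ⟨_, hm⟩
      exact ⟨x, smul_inv_smul (u ^ n) m⟩
  let K (i : Bool ×ₗ ℕ) := (relationPart (h.latticeAut M) B i).submoduleOf B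
  let π (i : Bool ×ₗ ℕ) : B →ₗ[J] B ⧸ K i := (K i).mkQ.restrictScalars J
  have hπ (i) : Function.Surjective (π i) := Submodule.Quotient.mk_surjective (K i)
  refine IsFreeAway.of_filtration (fun i ↦ φ (laurentExponent i)) π ?_ hπ (fun i ↦ ?_) hf
  · rw [laurentExponent_surjective.iSup_comp (fun n ↦ (φ n).range), iSup_congr hrange,
      ← Submodule.restrictScalars_iSup, h.iSup_zpow_latticeAut_eq_top hB,
      Submodule.restrictScalars_top]
  · simp only [hrange, ← Submodule.restrictScalars_iSup]
    ext x
    exact (Submodule.Quotient.mk_eq_zero (K i)).trans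
      (h.mem_relationPart.trans (and_iff_right x.2))

theorem IsLaurentExtension.isHallAlgebra [IsDomain J] {R : Subalgebra J S} {u : Sˣ}
    (h : IsLaurentExtension R u) (hR : IsHallAlgebra.{w} J R) : IsHallAlgebra.{w} J S := by
  have := hR.isNoetherianRing
  refine ⟨h.isNoetherianRing, ?_⟩
  intro M _ _ _ _ _
  obtain ⟨s, hs⟩ := Module.Finite.fg_top (R := S) (M := M)
  set B := Submodule.span R (s : Set M)
  have hB : Submodule.span S (B : Set M) = ⊤ :=
    top_unique (hs.ge.trans (Submodule.span_mono Submodule.subset_span))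
  have : IsNoetherian R B := isNoetherian_span_of_finite R s.finite_toSet
  have : WellFoundedGT (Set.Iic B) := (Submodule.mapIic B).symm.strictMono.wellFoundedGT
  have hfin := (finite_range_relationPart (h.latticeAut M) B).image (Submodule.submoduleOf · B)
  obtain ⟨f, hf0, hf⟩ := hR.exists_isFreeAway_quotient hfin
  exact ⟨f, hf0, h.isFreeAway hB fun i ↦ hf _ ⟨_, ⟨i, rfl⟩, rfl⟩⟩

end HallAlgebra

section NilpotentGroups

open Subgroup
open scoped commutatorElement

variable {G : Type*} [Group G]

theorem commutator_closure_le {S T : Set G} {N : Subgroup G} [N.Normal]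
    (h : ∀ s ∈ S, ∀ t ∈ T, ⁅s, t⁆ ∈ N) : ⁅closure S, closure T⁆ ≤ N := by
  rw [← QuotientGroup.ker_mk' N, ← Subgroup.map_eq_bot_iff, map_commutator, MonoidHom.map_closure,
    MonoidHom.map_closure, commutator_eq_bot_iff_le_centralizer, centralizer_closure, closure_le]
  rintro _ ⟨s, hs, rfl⟩
  refine mem_centralizer_iff.2 ?_
  rintro _ ⟨t, ht, rfl⟩
  rw [eq_comm, ← commutatorElement_eq_one_iff_mul_comm, ← map_commutatorElement]
  exact (QuotientGroup.eq_one_iff _).2 (h s hs t ht)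

theorem normal_of_lowerCentralSeries_le {N : Subgroup G} {n : ℕ}
    (h : (⊤ : Subgroup G).lowerCentralSeries (n + 1) ≤ N)
    (h' : N ≤ (⊤ : Subgroup G).lowerCentralSeries n) : N.Normal :=
  commutator_top_right_le_iff.1 ((commutator_mono h' le_rfl).trans h)

theorem exists_finite_closure_sup_lowerCentralSeries [Group.FG G] (n : ℕ) :
    ∃ C : Set G, C.Finite ∧ closure C ⊔ (⊤ : Subgroup G).lowerCentralSeries (n + 1) =
      (⊤ : Subgroup G).lowerCentralSeries n := by
  obtain ⟨S, hS, hSfin⟩ := Group.fg_iff.1 ‹Group.FG G›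
  induction n with
  | zero => exact ⟨S, hSfin, top_unique (hS.ge.trans le_sup_left)⟩
  | succ n ih =>
    obtain ⟨C, hCfin, hC⟩ := ih
    set L := (⊤ : Subgroup G).lowerCentralSeries
    have hCL : C ⊆ L n := (closure_le _).1 (le_sup_left.trans hC.le)
    refine ⟨Set.image2 (⁅·, ·⁆) C S, hCfin.image2 _ hSfin, ?_⟩
    set N := closure (Set.image2 (⁅·, ·⁆) C S) ⊔ L (n + 2)
    have hN : N ≤ L (n + 1) := by
      refine sup_le ((closure_le _).2 ?_) (Subgroup.lowerCentralSeries_antitone _ (n + 1).le_succ)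
      rintro _ ⟨c, hc, s, -, rfl⟩
      exact commutator_mem_commutator (hCL hc) (mem_top s)
    have : N.Normal := normal_of_lowerCentralSeries_le le_sup_right hN
    refine le_antisymm hN ?_
    calc L (n + 1) = ⁅closure (C ∪ L (n + 1)), closure S⁆ := by
          rw [Subgroup.closure_union, closure_eq, hC, hS]; rfl
      _ ≤ N := commutator_closure_le ?_
    rintro c (hc | hc) s hs
    · exact mem_sup_left (subset_closure ⟨c, hc, s, hs, rfl⟩)
    · exact mem_sup_right (commutator_mem_commutator hc (mem_top s))

theorem fg_nilpotent_induction [Group.FG G] [Group.IsNilpotent G] {P : Subgroup G → Prop}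
    (bot : P ⊥) (sup_zpowers : ∀ (H : Subgroup G) [H.Normal] (g : G), P H → P (H ⊔ zpowers g)) :
    P ⊤ := by
  set L := (⊤ : Subgroup G).lowerCentralSeries
  have hstep (n : ℕ) (hn : P (L (n + 1))) : P (L n) := by
    obtain ⟨C, hCfin, hC⟩ : ∃ C : Set G, C.Finite ∧ closure C ⊔ L (n + 1) = L n :=
      exists_finite_closure_sup_lowerCentralSeries n
    rw [← hC]
    refine Set.Finite.induction_on_subset (motive := fun F _ ↦ P (closure F ⊔ L (n + 1)))
      C hCfin (by rwa [Subgroup.closure_empty, bot_sup_eq]) fun {c F} _ hF _ ih ↦ ?_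
    have : (closure F ⊔ L (n + 1)).Normal := normal_of_lowerCentralSeries_le le_sup_right
      ((sup_le_sup_right (closure_mono hF) _).trans hC.le)
    have hcF := sup_zpowers _ c ih
    rwa [zpowers_eq_closure, sup_right_comm, ← Subgroup.closure_union, Set.union_comm,
      Set.singleton_union] at hcF
  have hL : L (Group.nilpotencyClass G) = ⊥ := Subgroup.lowerCentralSeries_nilpotencyClass
  exact Nat.decreasingInduction (motive := fun n _ ↦ P (L n)) (fun n _ ↦ hstep n) (hL ▸ bot)
    (Nat.zero_le _)

theorem exists_pow_mem_center [Group.FG G] {a : G}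
    (ha : ∀ x : G, ⁅x, a⁆ ∈ center G ∧ IsOfFinOrder ⁅x, a⁆) : ∃ m > 0, a ^ m ∈ center G := by
  obtain ⟨S, hS, hSfin⟩ := Group.fg_iff.1 ‹Group.FG G›
  choose n hn0 hn using fun x ↦ isOfFinOrder_iff_pow_eq_one.1 (ha x).2
  refine ⟨∏ x ∈ hSfin.toFinset, n x, Finset.prod_pos fun x _ ↦ hn0 x, ?_⟩
  set m := ∏ x ∈ hSfin.toFinset, n x
  have hcomm : S ⊆ centralizer {a ^ m} := by
    intro x hx
    obtain ⟨k, hk⟩ : n x ∣ m := Finset.dvd_prod_of_mem n (hSfin.mem_toFinset.2 hx)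
    have hpow : ⁅x, a⁆ ^ m = 1 := by rw [hk, pow_mul, hn, one_pow]
    have hcomm : Commute ⁅x, a⁆ a := (mem_center_iff.1 (ha x).1 a).symm
    have hconj : x * a ^ m * x⁻¹ = a ^ m := by
      rw [← conj_pow, ← MulAut.conj_apply, conj_eq_commutatorElement_mul, hcomm.mul_pow, hpow,
        one_mul]
    exact mem_centralizer_singleton_iff.2 (mul_inv_eq_iff_eq_mul.1 hconj)
  rw [← closure_le, hS] at hcomm
  exact mem_center_iff.2 fun y ↦ mem_centralizer_singleton_iff.1 (hcomm (mem_top y))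

theorem isOfFinOrder_of_mem_center_quotient [Group.FG G]
    (hZ : ∀ z ∈ center G, IsOfFinOrder z) {z : G ⧸ center G} (hz : z ∈ center (G ⧸ center G)) :
    IsOfFinOrder z := by
  obtain ⟨a, rfl⟩ := QuotientGroup.mk_surjective z
  have hcomm (x : G) : ⁅x, a⁆ ∈ center G := by
    rw [← QuotientGroup.eq_one_iff]
    exact commutatorElement_eq_one_iff_mul_comm.2 (mem_center_iff.1 hz x)
  obtain ⟨m, hm0, hm⟩ := exists_pow_mem_center fun x ↦ ⟨hcomm x, hZ _ (hcomm x)⟩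
  exact isOfFinOrder_iff_pow_eq_one.2 ⟨m, hm0, (QuotientGroup.eq_one_iff _).2 hm⟩

theorem isOfFinOrder_of_center [Group.IsNilpotent G] [Group.FG G]
    (hZ : ∀ z ∈ center G, IsOfFinOrder z) (g : G) : IsOfFinOrder g := by
  refine Group.nilpotent_center_quotient_ind (P := fun G _ _ ↦ Group.FG G →
    (∀ z ∈ center G, IsOfFinOrder z) → ∀ g : G, IsOfFinOrder g) G ?_ ?_ ‹_› hZ g
  · intro G _ _ _ _ g
    exact Subsingleton.elim 1 g ▸ IsOfFinOrder.one
  · intro G _ _ ih _ hZ g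
    have hQ (z) (hz : z ∈ center (G ⧸ center G)) : IsOfFinOrder z :=
      isOfFinOrder_of_mem_center_quotient hZ hz
    obtain ⟨n, hn0, hn⟩ := isOfFinOrder_iff_pow_eq_one.1 (ih inferInstance hQ g)
    exact (hZ _ ((QuotientGroup.eq_one_iff _).1 hn)).of_pow hn0.ne'

theorem finite_of_isOfFinOrder_center [Group.IsNilpotent G] [Group.FG G]
    (hZ : ∀ z ∈ center G, IsOfFinOrder z) : Finite G := by
  suffices Finite (⊤ : Subgroup G) from Finite.of_equiv _ topEquiv.toEquiv
  refine fg_nilpotent_induction (P := fun H ↦ Finite H) inferInstance fun H _ g hH ↦ ?_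
  have hzpowers : (zpowers g : Set G).Finite := finite_zpowers.2 (isOfFinOrder_of_center hZ g)
  have hmul := Set.Finite.mul (s := (H : Set G)) hH hzpowers
  rwa [← normal_mul] at hmul

end NilpotentGroups

section GroupRing

open MonoidAlgebra

variable {J H G : Type*} [CommRing J] [Group H] [Group G] {ι : H →* G}

theorem eq_top_of_forall_of_mem {A : Subalgebra J (MonoidAlgebra J G)} (hA : ∀ g, of J G g ∈ A) :
    A = ⊤ := by
  refine top_unique fun a _ ↦ ?_
  induction a using MonoidAlgebra.induction_on with
  | of g => exact hA g
  | add a b ha hb => exact add_mem (ha ⟨⟩) (hb ⟨⟩)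
  | smul c a ha => exact A.smul_mem (ha ⟨⟩) c

theorem mapDomainAlgHom_surjective (hι : Function.Surjective ι) :
    Function.Surjective (mapDomainAlgHom J J ι) := by
  rw [← AlgHom.range_eq_top]
  refine eq_top_of_forall_of_mem fun g ↦ ?_
  obtain ⟨h, rfl⟩ := hι g
  exact ⟨of J H h, mapDomain_single⟩

theorem of_mul_mul_of_inv_mem_range (hι : ι.range.Normal) (g : G)
    {r : MonoidAlgebra J G} (hr : r ∈ (mapDomainAlgHom J J ι).range) :
    of J G g * r * of J G g⁻¹ ∈ (mapDomainAlgHom J J ι).range := by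
  obtain ⟨a, rfl⟩ := hr
  induction a using MonoidAlgebra.induction_on with
  | of h =>
    obtain ⟨h', hh'⟩ := hι.conj_mem (ι h) ⟨h, rfl⟩ g
    have hof (x : H) : mapDomainAlgHom J J ι (of J H x) = of J G (ι x) := mapDomain_single
    exact ⟨of J H h', by simp only [RingHom.coe_coe, AlgHom.toRingHom_eq_coe, hof, hh', map_mul]⟩
  | add a b ha hb =>
    rw [map_add, mul_add, add_mul]
    exact add_mem ha hb
  | smul c a ha =>
    simp only [AlgHom.toRingHom_eq_coe, RingHom.coe_coe, map_smul, mul_smul_comm,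
      smul_mul_assoc] at ha ⊢
    exact Subalgebra.smul_mem _ ha c

theorem isLaurentExtension_range_mapDomainAlgHom (hι : ι.range.Normal) {g : G}
    (hg : ι.range ⊔ Subgroup.zpowers g = ⊤) :
    IsLaurentExtension (mapDomainAlgHom J J ι).range (Units.map (of J G) (toUnits g)) where
  conj_mem r hr := of_mul_mul_of_inv_mem_range hι g hr
  conj_inv_mem r hr := by
    have := of_mul_mul_of_inv_mem_range hι g⁻¹ hr
    rwa [inv_inv] at this
  adjoin_eq_top := by
    set A := Algebra.adjoin J ((mapDomainAlgHom J J ι).range ∪ _ : Set (MonoidAlgebra J G))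
    have hH (h : H) : of J G (ι h) ∈ A :=
      Algebra.subset_adjoin (Or.inl ⟨of J H h, mapDomain_single⟩)
    have hg₁ : of J G g ∈ A := Algebra.subset_adjoin (Or.inr (Or.inl rfl))
    have hg₂ : of J G g⁻¹ ∈ A := Algebra.subset_adjoin (Or.inr (Or.inr rfl))
    have hzpow (n : ℤ) : of J G (g ^ n) ∈ A := by
      obtain ⟨n, rfl | rfl⟩ := n.eq_nat_or_neg
      · rw [zpow_natCast, map_pow]
        exact pow_mem hg₁ n
      · rw [zpow_neg, zpow_natCast, ← inv_pow, map_pow]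
        exact pow_mem hg₂ n
    refine eq_top_of_forall_of_mem fun x ↦ ?_
    obtain ⟨_, ⟨h, rfl⟩, _, ⟨n, rfl⟩, rfl⟩ :=
      Subgroup.mem_sup_of_normal_left.1 (hg.ge (Subgroup.mem_top x))
    rw [map_mul]
    exact mul_mem (hH h) (hzpow n)

variable [IsDomain J]

theorem IsHallAlgebra.groupRing_of_sup_zpowers_eq_top
    (hH : IsHallAlgebra.{w} J (MonoidAlgebra J H)) (hι : ι.range.Normal) {g : G}
    (hg : ι.range ⊔ Subgroup.zpowers g = ⊤) : IsHallAlgebra.{w} J (MonoidAlgebra J G) :=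
  (isLaurentExtension_range_mapDomainAlgHom hι hg).isHallAlgebra
    (hH.of_surjective _ (mapDomainAlgHom J J ι).rangeRestrict_surjective)

theorem isHallAlgebra_groupRing_of_subsingleton [IsNoetherianRing J] [Subsingleton G] :
    IsHallAlgebra.{w} J (MonoidAlgebra J G) := by
  refine (isHallAlgebra_self J).of_surjective (Algebra.ofId J _) ?_
  rw [← AlgHom.range_eq_top]
  refine eq_top_of_forall_of_mem fun g ↦ ?_
  rw [Subsingleton.elim g 1, map_one]
  exact one_mem _

theorem sup_zpowers_subgroupOf (H : Subgroup G) (g : G) :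
    H.subgroupOf (H ⊔ Subgroup.zpowers g) ⊔
      Subgroup.zpowers ⟨g, Subgroup.mem_sup_right (Subgroup.mem_zpowers g)⟩ = ⊤ := by
  apply Subgroup.map_injective (H ⊔ Subgroup.zpowers g).subtype_injective
  rw [Subgroup.map_sup, Subgroup.map_subgroupOf_eq_of_le le_sup_left, MonoidHom.map_zpowers,
    ← MonoidHom.range_eq_map, Subgroup.range_subtype]
  rfl

theorem isHallAlgebra_groupRing [IsNoetherianRing J] [Group.FG G] [Group.IsNilpotent G] :
    IsHallAlgebra.{w} J (MonoidAlgebra J G) := by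
  have htop : IsHallAlgebra.{w} J (MonoidAlgebra J (⊤ : Subgroup G)) := by
    refine fg_nilpotent_induction (P := fun K ↦ IsHallAlgebra.{w} J (MonoidAlgebra J K))
      isHallAlgebra_groupRing_of_subsingleton fun H _ g hH ↦ ?_
    let ι : H →* (H ⊔ Subgroup.zpowers g : Subgroup G) := Subgroup.inclusion le_sup_left
    have hι : ι.range = H.subgroupOf _ := Subgroup.inclusion_range le_sup_left
    exact hH.groupRing_of_sup_zpowers_eq_top (ι := ι) (hι ▸ inferInstance)
      (hι ▸ sup_zpowers_subgroupOf H g)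
  exact htop.of_surjective _
    (mapDomainAlgHom_surjective (ι := (⊤ : Subgroup G).subtype) fun x ↦ ⟨⟨x, ⟨⟩⟩, rfl⟩)

end GroupRing

section SimpleModules

variable {J R : Type*} [CommRing J]

theorem isField_of_isUnit_of_isCoprime [IsDomain J] [IsJacobsonRing J] {f : J} (hf : f ≠ 0)
    (hunit : ∀ q : J, q ≠ 0 → IsCoprime q f → IsUnit q) : IsField J := by
  have hfJ : f ∉ (⊥ : Ideal J).jacobson := by
    rwa [IsJacobsonRing.out ‹_› (Ideal.isPrime_bot (α := J)).isRadical, Ideal.mem_bot]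
  rw [Ideal.mem_jacobson_bot] at hfJ
  push Not at hfJ
  obtain ⟨y, hy⟩ := hfJ
  have hfy : f * y + 1 = 0 := by
    by_contra hfy
    exact hy (hunit _ hfy ⟨1, -y, by ring⟩)
  have hfu : IsUnit f := .of_mul_eq_one (-y) (by linear_combination -hfy)
  by_contra hJ
  obtain ⟨q, hq, hqu⟩ := Ring.exists_not_isUnit_of_not_isField hJ
  exact hqu (hunit q hq ⟨0, ↑hfu.unit⁻¹, by rw [zero_mul, zero_add, hfu.val_inv_mul]⟩)

theorem isJacobsonRing_int : IsJacobsonRing ℤ := by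
  rw [isJacobsonRing_iff_prime_eq]
  intro P hP
  obtain rfl | hP₀ := eq_or_ne P ⊥
  · refine (Submodule.eq_bot_iff _).2 fun n hn ↦ ?_
    have hunit := Ideal.mem_jacobson_bot.1 hn (2 * n)
    rw [Int.isUnit_iff] at hunit
    rcases hunit with h | h <;> nlinarith
  · have := hP.isMaximal hP₀
    exact Ideal.jacobson_eq_self_of_isMaximal

theorem finite_of_isField_of_finiteType_int [Algebra ℤ J] [Algebra.FiniteType ℤ J]
    (hJ : IsField J) : Finite J := by
  obtain rfl := Subsingleton.elim ‹Algebra ℤ J› (Ring.toIntAlgebra J)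
  let := hJ.toField
  have := isJacobsonRing_int
  have : Module.Finite ℤ J := finite_of_finite_type_of_isJacobsonRing ℤ J
  obtain ⟨n, hn, hnJ⟩ : ∃ n : ℤ, n ≠ 0 ∧ (n : J) = 0 := by
    by_contra! hchar
    refine Int.not_isField (isField_of_isIntegral_of_isField (S := J) ?_ hJ)
    exact (injective_iff_map_eq_zero _).2 fun n hn ↦ by_contra fun h ↦ hchar n h hn
  refine Module.finite_of_fg_torsion J fun x ↦ ⟨⟨n, mem_nonZeroDivisors_of_ne_zero hn⟩, ?_⟩
  change n • x = 0
  rw [zsmul_eq_mul, hnJ, zero_mul]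

variable [Ring R] [Algebra J R] {V : Type w} [AddCommGroup V] [Module J V] [Module R V]
  [IsScalarTower J R V]

theorem smul_bijective_of_isSimpleModule [IsSimpleModule R V] [FaithfulSMul J V] {j : J}
    (hj : j ≠ 0) : Function.Bijective fun v : V ↦ j • v := by
  refine (Module.toModuleEnd R V j).bijective_or_eq_zero.resolve_right fun h ↦ hj ?_
  refine FaithfulSMul.eq_of_smul_eq_smul (α := V) fun v ↦ ?_
  rw [zero_smul]
  exact LinearMap.congr_fun h v

variable (V) in
theorem IsHallAlgebra.finite_of_isSimpleModule [IsDomain J] [Algebra ℤ J] [Algebra.FiniteType ℤ J]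
    [IsSimpleModule R V] [FaithfulSMul J V] (hR : IsHallAlgebra.{w} J R) : Finite J := by
  have := IsSimpleModule.nontrivial R V
  have := isJacobsonRing_int
  have : IsJacobsonRing J := isJacobsonRing_of_finiteType (A := ℤ)
  obtain ⟨f, hf, hfree⟩ := hR.exists_isFreeAway V
  refine finite_of_isField_of_finiteType_int (isField_of_isUnit_of_isCoprime hf fun q hq hqf ↦ ?_)
  exact hfree.isUnit_of_surjective_smul (smul_bijective_of_isSimpleModule (R := R) hf).injective
    (smul_bijective_of_isSimpleModule (R := R) hq).surjective hqf

end SimpleModules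

section GroupActions

open MonoidAlgebra

variable {G : Type*} [Group G] {V : Type w} [AddCommGroup V] [Module (MonoidAlgebra ℤ G) V]

/-- The action of `G` on a `ℤ[G]`-module `V`, by endomorphisms that are linear over a ring `J`
acting on `V` through `ℤ[G]`-endomorphisms. -/
noncomputable def groupAction (J V : Type*) [CommRing J] [AddCommGroup V]
    [Module (MonoidAlgebra ℤ G) V] [Module J V] [SMulCommClass (MonoidAlgebra ℤ G) J V] :
    G →* Module.End J V :=
  (Module.toModuleEnd J (S := MonoidAlgebra ℤ G) V).toMonoidHom.comp (of ℤ G)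

theorem finite_of_injective_toEnd [Group.FG G] [Group.IsNilpotent G]
    [IsSimpleModule (MonoidAlgebra ℤ G) V] {J : Type*} [CommRing J] [Algebra ℤ J]
    [Algebra.FiniteType ℤ J] {φ : J →+* Module.End (MonoidAlgebra ℤ G) V}
    (hφ : Function.Injective φ) : Finite J := by
  classical
  have : IsDomain J := hφ.isDomain φ
  have : IsNoetherianRing J := Algebra.FiniteType.isNoetherianRing ℤ J
  let _ : Module J V := Module.compHom V φ
  have : FaithfulSMul J V := ⟨fun h ↦ hφ (LinearMap.ext h)⟩
  have : SMulCommClass (MonoidAlgebra ℤ G) J V := ⟨fun a j v ↦ ((φ j).map_smul a v).symm⟩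
  let θ : MonoidAlgebra J G →ₐ[J] Module.End J V := MonoidAlgebra.lift J _ G (groupAction J V)
  let _ : Module (MonoidAlgebra J G) V := Module.compHom V θ.toRingHom
  have : IsScalarTower J (MonoidAlgebra J G) V :=
    ⟨fun j a v ↦ LinearMap.congr_fun (map_smul θ j a) v⟩
  have hsmul (a : MonoidAlgebra ℤ G) (v : V) :
      MonoidAlgebra.mapRingHom G (Int.castRingHom J) a • v = a • v := by
    change θ _ v = _
    induction a using MonoidAlgebra.induction_on with
    | of g =>
      have hg : mapRingHom G (Int.castRingHom J) (of ℤ G g) = of J G g := by simp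
      rw [hg, lift_of]
      rfl
    | add a b ha hb => rw [map_add, map_add, LinearMap.add_apply, ha, hb, add_smul]
    | smul n a ha => rw [map_zsmul, map_zsmul, LinearMap.smul_apply, ha, smul_assoc]
  have : IsSimpleModule (MonoidAlgebra J G) V := by
    refine isSimpleModule_iff_toSpanSingleton_surjective.2
      ⟨IsSimpleModule.nontrivial (MonoidAlgebra ℤ G) V, fun v hv w ↦ ?_⟩
    obtain ⟨a, rfl⟩ := IsSimpleModule.toSpanSingleton_surjective (MonoidAlgebra ℤ G) hv w
    exact ⟨_, hsmul a v⟩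
  exact (isHallAlgebra_groupRing (J := J) (G := G)).finite_of_isSimpleModule V

theorem isOfFinOrder_end [Group.FG G] [Group.IsNilpotent G] [IsSimpleModule (MonoidAlgebra ℤ G) V]
    {d : Module.End (MonoidAlgebra ℤ G) V} (hd : d ≠ 0) : IsOfFinOrder d := by
  classical
  let I := RingHom.ker (Polynomial.aeval (R := ℤ) d).toRingHom
  let φ : Polynomial ℤ ⧸ I →+* Module.End (MonoidAlgebra ℤ G) V := RingHom.kerLift _
  have hφ : Function.Injective φ := RingHom.kerLift_injective _
  have := finite_of_injective_toEnd hφ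
  have := hφ.isDomain φ
  obtain ⟨x, hx⟩ : ∃ x, φ x = d :=
    ⟨Ideal.Quotient.mk _ Polynomial.X, (RingHom.kerLift_mk _ _).trans (Polynomial.aeval_X d)⟩
  have hx₀ : x ≠ 0 := by
    rintro rfl
    exact hd (hx.symm.trans (map_zero φ))
  obtain ⟨y, hxy⟩ := (Finite.isField_of_domain _).mul_inv_cancel hx₀
  exact hx ▸ φ.toMonoidHom.isOfFinOrder (IsUnit.of_mul_eq_one y hxy).isOfFinOrder

variable (G V) in
/-- The kernel of the action of `G` on a `ℤ[G]`-module `V`. -/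
noncomputable def actionKernel : Subgroup G :=
  (groupAction ℤ V).ker

instance : (actionKernel G V).Normal := MonoidHom.normal_ker _

theorem mem_actionKernel {g : G} : g ∈ actionKernel G V ↔ ∀ v : V, of ℤ G g • v = v :=
  MonoidHom.mem_ker.trans LinearMap.ext_iff

theorem exists_end_apply_eq_of_smul {z : G}
    (hz : ∀ (g : G) (v : V), of ℤ G z • of ℤ G g • v = of ℤ G g • of ℤ G z • v) :
    ∃ d : Module.End (MonoidAlgebra ℤ G) V, ∀ v, d v = of ℤ G z • v := by
  refine ⟨{ toFun v := of ℤ G z • v, map_add' := smul_add _, map_smul' a v := ?_ }, fun _ ↦ rfl⟩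
  simp only [RingHom.id_apply]
  induction a using MonoidAlgebra.induction_on with
  | of g => exact hz g v
  | add a b ha hb => rw [add_smul, add_smul, smul_add, ha, hb]
  | smul n a ha => rw [smul_assoc, smul_assoc, smul_comm, ha]

theorem finite_quotient_actionKernel [Group.FG G] [Group.IsNilpotent G]
    [IsSimpleModule (MonoidAlgebra ℤ G) V] : Finite (G ⧸ actionKernel G V) := by
  have := IsSimpleModule.nontrivial (MonoidAlgebra ℤ G) V
  refine finite_of_isOfFinOrder_center fun z hz ↦ ?_
  induction z using QuotientGroup.induction_on with | H z
  have hcomm (g : G) (v : V) : of ℤ G z • of ℤ G g • v = of ℤ G g • of ℤ G z • v := by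
    have h : groupAction ℤ V (z * g) = groupAction ℤ V (g * z) :=
      (MonoidHom.eq_iff _).2 (QuotientGroup.eq.1 (Subgroup.mem_center_iff.1 hz g))
    rw [map_mul, map_mul] at h
    exact LinearMap.congr_fun h v
  obtain ⟨d, hd⟩ := exists_end_apply_eq_of_smul hcomm
  have hd₀ : d ≠ 0 := by
    rintro rfl
    obtain ⟨v, hv⟩ := exists_ne (0 : V)
    have h := congrArg (of ℤ G z⁻¹ • ·) (hd v)
    simp only [← mul_smul, ← map_mul, inv_mul_cancel, map_one, one_smul] at h
    exact hv (h.symm.trans (smul_zero _))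
  obtain ⟨n, hn, hdn⟩ := isOfFinOrder_iff_pow_eq_one.1 (isOfFinOrder_end hd₀)
  have hpow (k : ℕ) (v : V) : (d ^ k) v = of ℤ G (z ^ k) • v := by
    induction k with
    | zero => rw [pow_zero, pow_zero, Module.End.one_apply, map_one, one_smul]
    | succ k ih => rw [pow_succ', pow_succ', Module.End.mul_apply, hd, ih, map_mul, mul_smul]
  refine isOfFinOrder_iff_pow_eq_one.2 ⟨n, hn, ?_⟩
  rw [← QuotientGroup.mk_pow, QuotientGroup.eq_one_iff, mem_actionKernel]
  intro v
  rw [← hpow, hdn, Module.End.one_apply]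

theorem smul_eq_smul_of_groupRingProj_eq {H : Subgroup G} [H.Normal] (hH : H ≤ actionKernel G V)
    {a b : MonoidAlgebra ℤ G} (hab : groupRingProj H a = groupRingProj H b) (v : V) :
    a • v = b • v := by
  let θ : MonoidAlgebra ℤ (G ⧸ H) →+* Module.End ℤ V :=
    (MonoidAlgebra.lift ℤ _ _ (QuotientGroup.lift H (groupAction ℤ V) hH)).toRingHom
  have hθ : θ.comp (groupRingProj H) = Module.toModuleEnd ℤ V := by
    refine MonoidAlgebra.ringHom_ext' (RingHom.ext_int _ _) (MonoidHom.ext fun g ↦ ?_)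
    have hg : groupRingProj H (of ℤ G g) = of ℤ (G ⧸ H) g := mapDomain_single
    change θ (groupRingProj H (of ℤ G g)) = _
    rw [hg]
    exact lift_of _ _
  have hsmul (c : MonoidAlgebra ℤ G) : θ (groupRingProj H c) v = c • v :=
    LinearMap.congr_fun (RingHom.congr_fun hθ c) v
  rw [← hsmul, hab, hsmul]

theorem hasFinitelyDetectableFullLeftIdeals_of_finite_quotient_actionKernel {G : Type u} [Group G]
    (hG : ∀ (V : Type u) [AddCommGroup V] [Module (MonoidAlgebra ℤ G) V]
      [IsSimpleModule (MonoidAlgebra ℤ G) V], Finite (G ⧸ actionKernel G V)) :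
    HasFinitelyDetectableFullLeftIdeals G := by
  intro I hI
  by_contra hne
  obtain ⟨M, hM, hIM⟩ := Ideal.exists_le_maximal I hne
  let V := MonoidAlgebra ℤ G ⧸ M
  have : IsSimpleModule (MonoidAlgebra ℤ G) V := isSimpleModule_iff_isCoatom.2 hM.out
  have := hG V
  have : (actionKernel G V).FiniteIndex := Subgroup.finiteIndex_of_finite_quotient
  obtain ⟨a, haI, ha⟩ := (hI (actionKernel G V) inferInstance).ge (Set.mem_univ 1)
  have h := smul_eq_smul_of_groupRingProj_eq le_rfl (ha.trans (map_one _).symm)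
    (Submodule.Quotient.mk 1 : V)
  rw [one_smul, ← Submodule.Quotient.mk_smul, smul_eq_mul, mul_one,
    (Submodule.Quotient.mk_eq_zero M).2 (hIM haI), eq_comm, Submodule.Quotient.mk_eq_zero] at h
  exact hM.ne_top ((Ideal.eq_top_iff_one M).2 h)

end GroupActions

theorem mainTheorem7 (G : Type*) [Group G] [Group.FG G] [Group.IsNilpotent G] :
    HasFinitelyDetectableFullLeftIdeals G :=
  hasFinitelyDetectableFullLeftIdeals_of_finite_quotient_actionKernel
    fun _ ↦ finite_quotient_actionKernel
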